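/- Let $\alpha\in[0,1)$, ${\bf T}={\bf R}/{\bf Z}$, $\xi_n(x)=\exp(2\pi i n x)$ for $n\in{\bf Z}$. Let $\mathcal A_\alpha$ be the universal rotation $C^*$-algebra, i.e. the universal unital $C^*$-algebra generated by two unitaries $\widetilde U_\alpha,\widetilde V_\alpha$ with $\widetilde U_\alpha\widetilde V_\alpha=\exp(2\pi i\alpha)\widetilde V_\alpha\widetilde U_\alpha$. On $L^2({\bf T})$ let $(R(\alpha)f)(x)=f(x+\alpha)$ and $(M(\xi_1)f)(x)=\xi_1(x)f(x)$, and let $\mathcal B_\alpha\subset\mathcal B(L^2({\bf T}))$ be the $C^*$-algebra generated by $R(\alpha)$ and $M(\xi_1)$. For $\theta\in[0,1)$ let $\pi_\theta:\mathcal A_\alpha\to\mathcal B_\alpha$ be the unique unital $*$-homomorphism with $\pi_\theta(\widetilde U_\alpha)=\xi_1(\theta)R(\alpha)$ and $\pi_\theta(\widetilde V_\alpha)=M(\xi_1)$. For $\kappa,\lambda\in{\bf R}$ define the following operators on $L^2({\bf T})$: $$U_{kH}(\kappa,\alpha,\lambda,\theta)=\exp[-2i\kappa\cos(2\pi x)]\,\exp\Big[-2i\kappa\lambda\cos\Big(-i\alpha\frac{d}{dx}+2\pi\theta\Big)\Big],$$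 $$U_{ordkr}(\kappa,\alpha,\lambda,\theta)=\exp[-2i\kappa\cos(2\pi x)]\,T(\alpha)\,\exp[-2i\kappa\lambda\cos(2\pi(x+\theta))]\,T(\alpha)^{-1},\qquad T(\alpha)=\exp\Big(\frac{-i\alpha}{4\pi}\frac{d^2}{dx^2}\Big),$$ where functions of $d/dx$ act diagonally in the basis $(\xi_n)$, so that $T(\alpha)\xi_n=\exp(i\pi\alpha n^2)\xi_n$ and $\cos(-i\alpha\frac{d}{dx}+2\pi\theta)\xi_n=\cos(2\pi(n\alpha+\theta))\xi_n$. Then for every $\theta\in[0,1)$ the homomorphism $\pi_\theta$ is injective if and only if $\alpha$ is irrational. If $\alpha$ is irrational, then: 1. for every $\theta\in[0,1)$, $\pi_\theta$ is a bijection, and therefore $\mathcal A_\alpha\cong\mathcal B_\alpha$ as $C^*$-algebras; 2. $\sigma(A)=\sigma(\pi_\theta(A))$ for every $A\in\mathcal A_\alpha$ and every $\theta\in[0,1)$, where the spectrum of $\pi_\theta(A)$ may be taken in $\mathcal B_\alpha$ or in $\mathcal B(L^2({\bf T}))$; 3. $\sigma(U_{kH}(\kappa,\alpha,\lambda,\theta_1))=\sigma(U_{ordkr}(\kappa,\alpha,\lambda,\theta_2))$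 for all $\kappa,\lambda\in{\bf R}$ and all $\theta_1,\theta_2\in[0,1)$. -/

import Mathlib

open scoped ENNReal

/-- The group `*`-algebra `ℂ[F₂]` of the free group on two letters. The parameter only selects the
seminorm that is put on it below. -/
def RotationPre (_α : ℝ) : Type := MonoidAlgebra ℂ (FreeGroup (Fin 2))

namespace RotationPre

noncomputable section

variable {α : ℝ}

instance : Ring (RotationPre α) := inferInstanceAs (Ring (MonoidAlgebra ℂ (FreeGroup (Fin 2))))

instance : Algebra ℂ (RotationPre α) :=
  inferInstanceAs (Algebra ℂ (MonoidAlgebra ℂ (FreeGroup (Fin 2))))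

/-- The basis element of the group algebra indexed by `g`, times `c`. -/
def mono (g : FreeGroup (Fin 2)) (c : ℂ) : RotationPre α := MonoidAlgebra.single g c

theorem mono_mul (g h : FreeGroup (Fin 2)) (c d : ℂ) :
    (mono g c * mono h d : RotationPre α) = mono (g * h) (c * d) :=
  MonoidAlgebra.single_mul_single ..

theorem one_def : (1 : RotationPre α) = mono 1 1 := rfl

theorem smul_mono (c : ℂ) (g : FreeGroup (Fin 2)) (d : ℂ) :
    c • (mono g d : RotationPre α) = mono g (c * d) :=
  MonoidAlgebra.smul_single ..

theorem mono_add (g : FreeGroup (Fin 2)) (c d : ℂ) :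
    (mono g (c + d) : RotationPre α) = mono g c + mono g d :=
  MonoidAlgebra.single_add ..

theorem mono_zero (g : FreeGroup (Fin 2)) : (mono g 0 : RotationPre α) = 0 :=
  MonoidAlgebra.single_zero ..

theorem induction_linear {P : RotationPre α → Prop} (x : RotationPre α) (zero : P 0)
    (add : ∀ x y, P x → P y → P (x + y)) (single : ∀ g c, P (mono g c)) : P x :=
  MonoidAlgebra.induction_linear x zero add single

/-- The involution `∑ c_g g ↦ ∑ conj(c_g) g⁻¹`. -/
def starFun (x : RotationPre α) : RotationPre α :=
  (MonoidAlgebra.coeff x).sum fun g c => mono g⁻¹ (starRingEnd ℂ c)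

theorem starFun_zero : starFun (0 : RotationPre α) = 0 := Finsupp.sum_zero_index

theorem starFun_add (x y : RotationPre α) : starFun (x + y) = starFun x + starFun y :=
  Finsupp.sum_add_index' (fun g => by simp [mono_zero]) (fun g c d => by simp [mono_add])

theorem starFun_mono (g : FreeGroup (Fin 2)) (c : ℂ) :
    starFun (mono g c : RotationPre α) = mono g⁻¹ (starRingEnd ℂ c) :=
  Finsupp.sum_single_index (by simp [mono_zero])

instance : StarRing (RotationPre α) where
  star := starFun
  star_involutive x := by
    induction x using induction_linear with
    | zero => simp [starFun_zero]
    | add x y hx hy => rw [starFun_add, starFun_add, hx, hy]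
    | single g c => simp [starFun_mono]
  star_mul x y := by
    change starFun (x * y) = starFun y * starFun x
    induction x using induction_linear with
    | zero => simp [starFun_zero]
    | add x x' hx hx' => rw [add_mul, starFun_add, starFun_add, hx, hx', mul_add]
    | single g c =>
      induction y using induction_linear with
      | zero => simp [starFun_zero]
      | add y y' hy hy' => rw [mul_add, starFun_add, starFun_add, hy, hy', add_mul]
      | single h d => simp [starFun_mono, mono_mul, mul_comm]
  star_add := starFun_add

theorem star_mono (g : FreeGroup (Fin 2)) (c : ℂ) :
    star (mono g c : RotationPre α) = mono g⁻¹ (starRingEnd ℂ c) := starFun_mono g c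

instance : StarModule ℂ (RotationPre α) where
  star_smul c x := by
    induction x using induction_linear with
    | zero => simp
    | add x y hx hy => simp [smul_add, hx, hy]
    | single g d => simp [smul_mono, star_mono]

/-- The first generator. -/
def u : RotationPre α := mono (FreeGroup.of 0) 1

/-- The second generator. -/
def v : RotationPre α := mono (FreeGroup.of 1) 1

/-- `C*`-seminorms on `ℂ[F₂]` for which the relation `uv = exp(2πiα) vu` holds. -/
structure IsRotationSeminorm (p : Seminorm ℂ (RotationPre α)) : Prop where
  mul_le : ∀ x y, p (x * y) ≤ p x * p y
  cstar : ∀ x, p (star x * x) = p x ^ 2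
  rel : p (u * v - Complex.exp (2 * Real.pi * Complex.I * α) • (v * u)) = 0

theorem isRotationSeminorm_zero : IsRotationSeminorm (0 : Seminorm ℂ (RotationPre α)) :=
  ⟨by simp, by simp, by simp⟩

instance : Nonempty {p : Seminorm ℂ (RotationPre α) // IsRotationSeminorm p} :=
  ⟨⟨0, isRotationSeminorm_zero⟩⟩

theorem IsRotationSeminorm.mono_le {p : Seminorm ℂ (RotationPre α)} (hp : IsRotationSeminorm p)
    (g : FreeGroup (Fin 2)) : p (mono g 1) ≤ 1 := by
  have h1 : p 1 = p 1 ^ 2 := by simpa using hp.cstar 1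
  have hg : p 1 = p (mono g 1) ^ 2 := by
    rw [← hp.cstar, star_mono, mono_mul, one_def]; simp
  have h0 := apply_nonneg p (1 : RotationPre α)
  nlinarith [sq_nonneg (p (mono g 1) - 1), sq_nonneg (p 1 - 1)]

theorem bddAbove (x : RotationPre α) :
    BddAbove (Set.range fun p : {p : Seminorm ℂ (RotationPre α) // IsRotationSeminorm p} =>
      p.1 x) := by
  induction x using induction_linear with
  | zero => exact ⟨0, by rintro _ ⟨p, rfl⟩; simp⟩
  | add x y hx hy =>
    obtain ⟨a, ha⟩ := hx
    obtain ⟨b, hb⟩ := hy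
    refine ⟨a + b, ?_⟩
    rintro _ ⟨p, rfl⟩
    exact (map_add_le_add p.1 x y).trans (add_le_add (ha ⟨p, rfl⟩) (hb ⟨p, rfl⟩))
  | single g c =>
    refine ⟨‖c‖, ?_⟩
    rintro _ ⟨p, rfl⟩
    have : (mono g c : RotationPre α) = c • mono g 1 := by simp [smul_mono]
    simp only [this, map_smul_eq_mul]
    exact mul_le_of_le_one_right (norm_nonneg c) (p.2.mono_le g)

/-- The largest `C*`-seminorm on `ℂ[F₂]` for which the rotation relation holds. -/
instance : Norm (RotationPre α) where
  norm x := ⨆ p : {p : Seminorm ℂ (RotationPre α) // IsRotationSeminorm p}, p.1 x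

theorem norm_def (x : RotationPre α) :
    ‖x‖ = ⨆ p : {p : Seminorm ℂ (RotationPre α) // IsRotationSeminorm p}, p.1 x := rfl

theorem le_norm {p : Seminorm ℂ (RotationPre α)} (hp : IsRotationSeminorm p)
    (x : RotationPre α) : p x ≤ ‖x‖ :=
  le_ciSup (bddAbove x) ⟨p, hp⟩

theorem norm_le {x : RotationPre α} {C : ℝ}
    (h : ∀ p : Seminorm ℂ (RotationPre α), IsRotationSeminorm p → p x ≤ C) : ‖x‖ ≤ C :=
  ciSup_le fun p => h p.1 p.2

theorem norm_nonneg' (x : RotationPre α) : 0 ≤ ‖x‖ := by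
  simpa using le_norm isRotationSeminorm_zero x

theorem norm_smul_le' (c : ℂ) (x : RotationPre α) : ‖c • x‖ ≤ ‖c‖ * ‖x‖ :=
  norm_le fun p hp => by
    rw [map_smul_eq_mul]; exact mul_le_mul_of_nonneg_left (le_norm hp x) (norm_nonneg c)

theorem norm_neg' (x : RotationPre α) : ‖-x‖ = ‖x‖ := by simp [norm_def]

instance : SeminormedRing (RotationPre α) where
  dist x y := ‖-x + y‖
  dist_self x := by simp [norm_def]
  dist_comm x y := by rw [← norm_neg']; congr 1; abel
  dist_triangle x y z := norm_le fun p hp => by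
    have : -x + z = (-x + y) + (-y + z) := by abel
    rw [this]
    exact (map_add_le_add p _ _).trans (add_le_add (le_norm hp _) (le_norm hp _))
  dist_eq x y := rfl
  norm_mul_le x y := norm_le fun p hp =>
    (hp.mul_le x y).trans
      (mul_le_mul (le_norm hp x) (le_norm hp y) (apply_nonneg p y) (norm_nonneg' x))

instance : NormedAlgebra ℂ (RotationPre α) where
  norm_smul_le := norm_smul_le'

theorem norm_star_mul_self' (x : RotationPre α) : ‖star x * x‖ = ‖x‖ ^ 2 := by
  rw [norm_def, norm_def]
  exact (iSup_congr fun p => p.2.cstar x).trans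
    (Real.iSup_pow (f := fun p : {p : Seminorm ℂ (RotationPre α) // IsRotationSeminorm p} =>
      p.1 x) (fun p => apply_nonneg p.1 x) 2).symm

theorem norm_le_norm_star (x : RotationPre α) : ‖x‖ ≤ ‖star x‖ := by
  have h1 := norm_star_mul_self' x
  have h2 := norm_mul_le (star x) x
  by_contra! h
  nlinarith [norm_nonneg (star x), norm_nonneg x]

instance : NormedStarGroup (RotationPre α) where
  norm_star_le x := by simpa using norm_le_norm_star (star x)

theorem rel_norm : ‖(u * v - Complex.exp (2 * Real.pi * Complex.I * α) • (v * u) :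
    RotationPre α)‖ = 0 :=
  le_antisymm (norm_le fun _ hp => hp.rel.le) (norm_nonneg _)

end

end RotationPre

/-- A pair of unitaries in a unital `C*`-algebra with `U V = exp(2πiα) V U`. -/
structure IsRotationPair {D : Type*} [CStarAlgebra D] (α : ℝ) (U V : D) : Prop where
  unitary_left : U ∈ unitary D
  unitary_right : V ∈ unitary D
  comm : U * V = Complex.exp (2 * Real.pi * Complex.I * α) • (V * U)

/-- The universal rotation `C*`-algebra: the completion of `ℂ[F₂]` with respect to the largest
`C*`-seminorm for which the two generators satisfy `uv = exp(2πiα) vu`. -/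
def RotationAlgebra (α : ℝ) : Type := UniformSpace.Completion (RotationPre α)

namespace RotationAlgebra

open UniformSpace

noncomputable section

variable {α : ℝ}

instance : NormedRing (RotationAlgebra α) :=
  inferInstanceAs (NormedRing (Completion (RotationPre α)))

instance : CompleteSpace (RotationAlgebra α) :=
  inferInstanceAs (CompleteSpace (Completion (RotationPre α)))

instance : NormedAlgebra ℂ (RotationAlgebra α) where
  __ := (inferInstance : Algebra ℂ (Completion (RotationPre α)))
  norm_smul_le c x := norm_smul_le (β := Completion (RotationPre α)) c x

/-- The canonical map of the group algebra into its completion. -/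
def ofPre : RotationPre α →ₐ[ℂ] RotationAlgebra α where
  __ := (Completion.coeRingHom : RotationPre α →+* Completion (RotationPre α))
  commutes' _ := rfl

theorem norm_ofPre (x : RotationPre α) : ‖ofPre x‖ = ‖x‖ := Completion.norm_coe x

theorem continuous_ofPre : Continuous (ofPre : RotationPre α → RotationAlgebra α) :=
  Completion.continuous_coe _

theorem denseRange_ofPre : DenseRange (ofPre : RotationPre α → RotationAlgebra α) :=
  Completion.denseRange_coe

theorem induction_on {P : RotationAlgebra α → Prop} (x : RotationAlgebra α)
    (hc : IsClosed {x | P x}) (h : ∀ x, P (ofPre x)) : P x :=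
  Completion.induction_on x hc h

theorem induction_on₂ {P : RotationAlgebra α → RotationAlgebra α → Prop}
    (x y : RotationAlgebra α)
    (hc : IsClosed {x : RotationAlgebra α × RotationAlgebra α | P x.1 x.2})
    (h : ∀ x y, P (ofPre x) (ofPre y)) : P x y :=
  Completion.induction_on₂ x y hc h

instance : Star (RotationAlgebra α) where
  star := Completion.map (star : RotationPre α → RotationPre α)

theorem continuous_star' : Continuous (star : RotationAlgebra α → RotationAlgebra α) :=
  Completion.continuous_map

theorem star_ofPre (x : RotationPre α) : star (ofPre x) = ofPre (star x) :=
  Completion.map_coe (uniformContinuous_of_continuousAt_zero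
    (starAddEquiv : RotationPre α ≃+ RotationPre α) continuous_star.continuousAt) x

instance : ContinuousStar (RotationAlgebra α) := ⟨continuous_star'⟩

theorem star_star' (x : RotationAlgebra α) : star (star x) = x := by
  refine induction_on (P := fun x => star (star x) = x) x
    (isClosed_eq (by fun_prop) (by fun_prop)) fun x => ?_
  rw [star_ofPre, star_ofPre, star_star]

theorem star_mul' (x y : RotationAlgebra α) : star (x * y) = star y * star x := by
  refine induction_on₂ (P := fun x y => star (x * y) = star y * star x) x y
    (isClosed_eq (by fun_prop) (by fun_prop)) fun x y => ?_
  rw [← map_mul, star_ofPre, star_mul, map_mul, star_ofPre, star_ofPre]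

theorem star_add' (x y : RotationAlgebra α) : star (x + y) = star x + star y := by
  refine induction_on₂ (P := fun x y => star (x + y) = star x + star y) x y
    (isClosed_eq (by fun_prop) (by fun_prop)) fun x y => ?_
  rw [← map_add, star_ofPre, star_add, map_add, star_ofPre, star_ofPre]

theorem star_smul' (c : ℂ) (x : RotationAlgebra α) : star (c • x) = star c • star x := by
  have h1 : Continuous fun x : RotationAlgebra α => star (c • x) :=
    continuous_star'.comp (continuous_const_smul c)
  have h2 : Continuous fun x : RotationAlgebra α => star c • star x :=
    (continuous_const_smul (star c)).comp continuous_star'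
  refine induction_on (P := fun x => star (c • x) = star c • star x) x
    (isClosed_eq h1 h2) fun x => ?_
  rw [← map_smul, star_ofPre, star_smul, map_smul, star_ofPre]

theorem norm_star_mul_self' (x : RotationAlgebra α) : ‖x‖ * ‖x‖ = ‖star x * x‖ := by
  refine induction_on (P := fun x => ‖x‖ * ‖x‖ = ‖star x * x‖) x
    (isClosed_eq (by fun_prop) (by fun_prop)) fun x => ?_
  rw [star_ofPre, ← map_mul, norm_ofPre, norm_ofPre, RotationPre.norm_star_mul_self', sq]

instance : StarRing (RotationAlgebra α) where
  star_involutive := star_star'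
  star_mul := star_mul'
  star_add := star_add'

instance : CStarAlgebra (RotationAlgebra α) where
  norm_mul_self_le x := (norm_star_mul_self' x).le
  star_smul := star_smul'

variable (α) in
/-- The first canonical generator of the universal rotation algebra. -/
def U : RotationAlgebra α := ofPre RotationPre.u

variable (α) in
/-- The second canonical generator of the universal rotation algebra. -/
def V : RotationAlgebra α := ofPre RotationPre.v

theorem ofPre_mono_mem_unitary (g : FreeGroup (Fin 2)) :
    (ofPre (RotationPre.mono g 1) : RotationAlgebra α) ∈ unitary (RotationAlgebra α) := by
  constructor <;>
  · rw [star_ofPre, ← map_mul, RotationPre.star_mono, RotationPre.mono_mul]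
    simp [← RotationPre.one_def]

theorem isRotationPair : IsRotationPair α (U α) (V α) where
  unitary_left := ofPre_mono_mem_unitary _
  unitary_right := ofPre_mono_mem_unitary _
  comm := by
    have h := (norm_ofPre (RotationPre.u * RotationPre.v -
      Complex.exp (2 * Real.pi * Complex.I * α) • (RotationPre.v * RotationPre.u) :
        RotationPre α)).trans RotationPre.rel_norm
    rwa [norm_eq_zero, map_sub, map_smul, map_mul, map_mul, sub_eq_zero] at h

section Lift

variable {D : Type*} [CStarAlgebra D] {X Y : D}

/-- The `*`-homomorphism of the group algebra given by two unitaries. -/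
def preLift (h : IsRotationPair α X Y) : RotationPre α →ₐ[ℂ] D :=
  MonoidAlgebra.lift ℂ D (FreeGroup (Fin 2))
    ((unitary D).subtype.comp (FreeGroup.lift ![⟨X, h.unitary_left⟩, ⟨Y, h.unitary_right⟩] :
      FreeGroup (Fin 2) →* unitary D))

theorem preLift_mono (h : IsRotationPair α X Y) (g : FreeGroup (Fin 2)) (c : ℂ) :
    preLift h (RotationPre.mono g c) = c •
      ((FreeGroup.lift ![⟨X, h.unitary_left⟩, ⟨Y, h.unitary_right⟩] g : unitary D) : D) :=
  MonoidAlgebra.lift_single ..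

theorem preLift_u (h : IsRotationPair α X Y) : preLift h RotationPre.u = X := by
  simp [RotationPre.u, preLift_mono]

theorem preLift_v (h : IsRotationPair α X Y) : preLift h RotationPre.v = Y := by
  simp [RotationPre.v, preLift_mono]

theorem preLift_star (h : IsRotationPair α X Y) (x : RotationPre α) :
    preLift h (star x) = star (preLift h x) := by
  induction x using RotationPre.induction_linear with
  | zero => simp
  | add x y hx hy => simp [hx, hy]
  | single g c =>
    rw [RotationPre.star_mono, preLift_mono, preLift_mono, star_smul, map_inv]
    rfl

theorem isRotationSeminorm (h : IsRotationPair α X Y) :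
    RotationPre.IsRotationSeminorm ((normSeminorm ℂ D).comp (preLift h).toLinearMap) where
  mul_le x y := by simpa using norm_mul_le (preLift h x) (preLift h y)
  cstar x := by
    simpa [preLift_star, sq] using CStarRing.norm_star_mul_self (x := preLift h x)
  rel := by simp [preLift_u, preLift_v, h.comm]

theorem norm_preLift_le (h : IsRotationPair α X Y) (x : RotationPre α) :
    ‖preLift h x‖ ≤ ‖x‖ :=
  RotationPre.le_norm (isRotationSeminorm h) x

theorem continuous_preLift (h : IsRotationPair α X Y) : Continuous (preLift h) :=
  AddMonoidHomClass.continuous_of_bound (preLift h) 1 (by simpa using norm_preLift_le h)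

/-- The homomorphism `lift` without its compatibility with the involution. -/
def liftAlg (h : IsRotationPair α X Y) : RotationAlgebra α →ₐ[ℂ] D where
  __ := (Completion.extensionHom (preLift h).toRingHom (continuous_preLift h) :
    Completion (RotationPre α) →+* D)
  commutes' c := (Completion.extensionHom_coe (preLift h).toRingHom (continuous_preLift h)
    (algebraMap ℂ (RotationPre α) c)).trans ((preLift h).commutes c)

theorem continuous_liftAlg (h : IsRotationPair α X Y) : Continuous (liftAlg h) :=
  Completion.continuous_extension

theorem liftAlg_ofPre (h : IsRotationPair α X Y) (x : RotationPre α) :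
    liftAlg h (ofPre x) = preLift h x :=
  Completion.extensionHom_coe (preLift h).toRingHom (continuous_preLift h) x

theorem liftAlg_star (h : IsRotationPair α X Y) (x : RotationAlgebra α) :
    liftAlg h (star x) = star (liftAlg h x) := by
  have hc := continuous_liftAlg h
  refine induction_on (P := fun x => liftAlg h (star x) = star (liftAlg h x)) x
    (isClosed_eq (by fun_prop) (by fun_prop)) fun x => ?_
  rw [star_ofPre, liftAlg_ofPre, liftAlg_ofPre, preLift_star]

/-- The `*`-homomorphism out of the universal rotation algebra determined by a rotation pair. -/
def lift (h : IsRotationPair α X Y) : RotationAlgebra α →⋆ₐ[ℂ] D where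
  __ := liftAlg h
  map_star' := liftAlg_star h

theorem lift_ofPre (h : IsRotationPair α X Y) (x : RotationPre α) :
    lift h (ofPre x) = preLift h x := liftAlg_ofPre h x

@[simp]
theorem lift_U (h : IsRotationPair α X Y) : lift h (U α) = X :=
  (lift_ofPre h _).trans (preLift_u h)

@[simp]
theorem lift_V (h : IsRotationPair α X Y) : lift h (V α) = Y :=
  (lift_ofPre h _).trans (preLift_v h)

end Lift

/-- The canonical pair generates the universal rotation algebra as a `C*`-algebra. -/
theorem topologicalClosure_adjoin :
    (StarAlgebra.adjoin ℂ {U α, V α}).topologicalClosure = ⊤ := by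
  have key : ∀ x : RotationPre α, ofPre x ∈ StarAlgebra.adjoin ℂ {U α, V α} := by
    intro x
    induction x using RotationPre.induction_linear with
    | zero => simp
    | add x y hx hy => rw [map_add]; exact add_mem hx hy
    | single g c =>
      have hsm : (RotationPre.mono g c : RotationPre α) = c • RotationPre.mono g 1 := by
        simp [RotationPre.smul_mono]
      rw [hsm, map_smul]
      clear hsm
      refine SMulMemClass.smul_mem c ?_
      have hgen : ∀ i : Fin 2, ofPre (RotationPre.mono (FreeGroup.of i) 1) ∈
          StarAlgebra.adjoin ℂ {U α, V α} := by
        intro i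
        fin_cases i
        · exact StarAlgebra.subset_adjoin _ _ (Or.inl rfl)
        · exact StarAlgebra.subset_adjoin _ _ (Or.inr rfl)
      induction g using FreeGroup.induction_on with
      | C1 => rw [← RotationPre.one_def, map_one]; exact one_mem _
      | of i => exact hgen i
      | inv_of i _ =>
        have := star_mem (hgen i)
        rwa [star_ofPre, RotationPre.star_mono, map_one] at this
      | mul g h hg hh =>
        have : (RotationPre.mono (g * h) 1 : RotationPre α) =
            RotationPre.mono g 1 * RotationPre.mono h 1 := by simp [RotationPre.mono_mul]
        rw [this, map_mul]
        exact mul_mem hg hh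
  refine eq_top_iff.2 fun x _ => ?_
  refine closure_mono ?_ (denseRange_ofPre x)
  rintro _ ⟨y, rfl⟩
  exact key y

/-- The universal property of the universal rotation algebra. -/
theorem existsUnique_lift {D : Type*} [CStarAlgebra D] {X Y : D} (h : IsRotationPair α X Y) :
    ∃! π : RotationAlgebra α →⋆ₐ[ℂ] D, π (U α) = X ∧ π (V α) = Y := by
  refine ⟨lift h, ⟨lift_U h, lift_V h⟩, fun π hπ => ?_⟩
  have hcont : ∀ φ : RotationAlgebra α →⋆ₐ[ℂ] D, Continuous φ := fun φ =>
    AddMonoidHomClass.continuous_of_bound φ 1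
      (by simpa using NonUnitalStarAlgHom.norm_apply_le φ)
  have hcl : (StarAlgHom.equalizer π (lift h)).topologicalClosure ≤
      StarAlgHom.equalizer π (lift h) :=
    StarSubalgebra.topologicalClosure_minimal le_rfl
      (isClosed_eq (hcont π) (hcont (lift h)))
  have : (⊤ : StarSubalgebra ℂ (RotationAlgebra α)) ≤ StarAlgHom.equalizer π (lift h) := by
    rw [← topologicalClosure_adjoin]
    refine (StarSubalgebra.topologicalClosure_mono (StarAlgebra.adjoin_le ?_)).trans hcl
    rintro x (rfl | rfl)
    · exact hπ.1.trans (lift_U h).symm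
    · exact hπ.2.trans (lift_V h).symm
  exact StarAlgHom.ext fun x => this (StarSubalgebra.mem_top)

end

end RotationAlgebra

noncomputable section

namespace KickedRotor

open MeasureTheory AddCircle

/-- The Hilbert space `L²(𝕋)`, with `𝕋 = ℝ/ℤ` carrying its Haar probability measure. -/
abbrev L2T : Type := Lp ℂ 2 (haarAddCircle : Measure UnitAddCircle)

/-- Multiplication `f ↦ g f` by `g ∈ L^∞(𝕋)`. -/
def mulOp (g : Lp ℂ ∞ (haarAddCircle : Measure UnitAddCircle)) : L2T →L[ℂ] L2T :=
  (ContinuousLinearMap.mul ℂ ℂ).holderL (haarAddCircle : Measure UnitAddCircle) ∞ 2 2 g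

/-- The multiplication operator by `ξ₁(x) = exp(2πix)`. -/
def Mξ : L2T →L[ℂ] L2T := mulOp (fourierLp ∞ 1)

/-- The rotation `(R(α) f)(x) = f(x + α)`. -/
def rot (α : ℝ) : L2T →L[ℂ] L2T :=
  (Lp.compMeasurePreservingₗᵢ ℂ (fun x : UnitAddCircle => x + (α : UnitAddCircle))
    (measurePreserving_add_right haarAddCircle (α : UnitAddCircle))).toContinuousLinearMap

/-- The number `ξ₁(θ) = exp(2πiθ)`. -/
def ξ (θ : ℝ) : ℂ := Complex.exp (2 * Real.pi * Complex.I * θ)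

/-- The operator on `L²(𝕋)` that is diagonal in the basis `ξ_n(x) = exp(2πinx)`, with bounded
eigenvalue sequence `m`; this is `φ(-i d/dx)` when `m n = φ(2πn)`. -/
def fourierMultiplier (m : lp (fun _ : ℤ => ℂ) ∞) : L2T →L[ℂ] L2T :=
  fourierBasis.repr.symm.toContinuousLinearEquiv.toContinuousLinearMap ∘L
    lp.mapCLM 2 (fun n => ContinuousLinearMap.mul ℂ ℂ (m n)) (norm_nonneg m)
      (fun n => (ContinuousLinearMap.opNorm_mul_apply_le ℂ ℂ (m n)).trans
        (lp.norm_apply_le_norm ENNReal.top_ne_zero m n)) ∘L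
    fourierBasis.repr.toContinuousLinearEquiv.toContinuousLinearMap

theorem fourierMultiplier_fourierLp (m : lp (fun _ : ℤ => ℂ) ∞) (n : ℤ) :
    fourierMultiplier m (fourierLp 2 n) = m n • fourierLp 2 n := by
  have h : (fourierLp 2 n : L2T) = fourierBasis n := by rw [coe_fourierBasis]
  rw [h]
  apply fourierBasis.repr.injective
  ext k
  by_cases hk : k = n
  · subst hk; simp [fourierMultiplier]
  · have h0 : (fourierBasis.repr (fourierLp 2 n : L2T) : ℤ → ℂ) k = 0 := by
      rw [h, HilbertBasis.repr_self]; simp [hk]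
    simp [fourierMultiplier, h0]

theorem memℓp_of_norm_le_one {m : ℤ → ℂ} (h : ∀ n, ‖m n‖ ≤ 1) : Memℓp m ∞ :=
  memℓp_infty ⟨1, by rintro _ ⟨n, rfl⟩; exact h n⟩

/-- The free propagator `T(α) = exp(-(iα/4π) d²/dx²)`. Since `d²/dx² ξ_n = -(2πn)² ξ_n`, it
multiplies `ξ_n` by `exp(iπαn²)`. -/
def freeProp (α : ℝ) : L2T →L[ℂ] L2T :=
  fourierMultiplier ⟨fun n => Complex.exp ((Real.pi * α * (n : ℝ) ^ 2 : ℝ) * Complex.I),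
    memℓp_of_norm_le_one fun _ => (Complex.norm_exp_ofReal_mul_I _).le⟩

/-- The operator `cos(-iα d/dx + 2πθ)`. Since `-iα d/dx ξ_n = 2πnα ξ_n`, it multiplies `ξ_n` by
`cos(2π(nα + θ))`. -/
def cosMomentum (α θ : ℝ) : L2T →L[ℂ] L2T :=
  fourierMultiplier ⟨fun n => (Real.cos (2 * Real.pi * (n * α + θ)) : ℝ),
    memℓp_of_norm_le_one fun _ => by
      rw [Complex.norm_real]; exact Real.abs_cos_le_one _⟩

/-- The function `x ↦ cos(2π(x + θ))` on `𝕋`. -/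
def cosFun (θ : ℝ) : C(UnitAddCircle, ℂ) where
  toFun x := ((fourier 1 (x + (θ : UnitAddCircle)) : ℂ).re : ℂ)
  continuous_toFun := by fun_prop

theorem cosFun_coe (θ x : ℝ) :
    cosFun θ (x : UnitAddCircle) = Real.cos (2 * Real.pi * (x + θ)) := by
  change ((fourier 1 ((x : UnitAddCircle) + (θ : UnitAddCircle)) : ℂ).re : ℂ) = _
  rw [← AddCircle.coe_add, fourier_coe_apply]
  congr 1
  rw [← Complex.exp_ofReal_mul_I_re]
  congr 2
  push_cast
  ring

/-- Multiplication by `cos(2π(x + θ))`. -/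
def cosPosition (θ : ℝ) : L2T →L[ℂ] L2T :=
  mulOp (ContinuousMap.toLp ∞ (haarAddCircle : Measure UnitAddCircle) ℂ (cosFun θ))

theorem ext_fourierLp {A B : L2T →L[ℂ] L2T}
    (h : ∀ n : ℤ, A (fourierLp 2 n) = B (fourierLp 2 n)) : A = B := by
  have hd : Dense (Submodule.span ℂ (Set.range (fourierLp (T := 1) 2)) : Set L2T) :=
    Submodule.dense_iff_topologicalClosure_eq_top.2
      (span_fourierLp_closure_eq_top (by norm_num))
  refine ContinuousLinearMap.ext_on hd ?_
  rintro _ ⟨n, rfl⟩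
  exact h n

theorem freeProp_fourierLp (α : ℝ) (n : ℤ) : freeProp α (fourierLp 2 n) =
    Complex.exp ((Real.pi * α * (n : ℝ) ^ 2 : ℝ) * Complex.I) • fourierLp 2 n :=
  fourierMultiplier_fourierLp _ n

theorem cosMomentum_fourierLp (α θ : ℝ) (n : ℤ) : cosMomentum α θ (fourierLp 2 n) =
    (Real.cos (2 * Real.pi * (n * α + θ)) : ℂ) • fourierLp 2 n :=
  fourierMultiplier_fourierLp _ n

theorem freeProp_mul_neg (α : ℝ) : freeProp α * freeProp (-α) = 1 := by
  refine ext_fourierLp fun n => ?_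
  rw [mul_apply_eq_comp, freeProp_fourierLp, map_smul, freeProp_fourierLp, smul_smul,
    ← Complex.exp_add]
  simp

theorem freeProp_neg_mul (α : ℝ) : freeProp (-α) * freeProp α = 1 := by
  simpa using freeProp_mul_neg (-α)

/-- The kicked Harper operator
`exp[-2iκ cos(2πx)] exp[-2iκλ cos(-iα d/dx + 2πθ)]`. -/
def kickedHarper (κ α lam θ : ℝ) : L2T →L[ℂ] L2T :=
  NormedSpace.exp ((-2 * Complex.I * κ) • cosPosition 0) *
    NormedSpace.exp ((-2 * Complex.I * κ * lam) • cosMomentum α θ)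

/-- The on-resonance double kicked rotor operator
`exp[-2iκ cos(2πx)] T(α) exp[-2iκλ cos(2π(x + θ))] T(α)⁻¹`, where `T(α)⁻¹ = T(-α)`. -/
def doubleKickedRotor (κ α lam θ : ℝ) : L2T →L[ℂ] L2T :=
  NormedSpace.exp ((-2 * Complex.I * κ) • cosPosition 0) * freeProp α *
    NormedSpace.exp ((-2 * Complex.I * κ * lam) • cosPosition θ) * freeProp (-α)

/-- The rotation `C*`-algebra on `L²(𝕋)`: the `C*`-algebra of operators generated by `R(α)` and
multiplication by `ξ₁`. -/
def rotationOperatorAlgebra (α : ℝ) : StarSubalgebra ℂ (L2T →L[ℂ] L2T) :=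
  (StarAlgebra.adjoin ℂ {rot α, Mξ}).topologicalClosure

instance (α : ℝ) : IsClosed (rotationOperatorAlgebra α : Set (L2T →L[ℂ] L2T)) :=
  StarSubalgebra.isClosed_topologicalClosure _

instance (α : ℝ) : CStarAlgebra (rotationOperatorAlgebra α) := StarSubalgebra.cstarAlgebra _

theorem mulOp_coeFn (g : Lp ℂ ∞ (haarAddCircle : Measure UnitAddCircle)) (f : L2T) :
    mulOp g f =ᵐ[haarAddCircle] fun x => g x * f x :=
  (ContinuousLinearMap.mul ℂ ℂ).coeFn_holder g f

theorem rot_coeFn (α : ℝ) (f : L2T) :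
    rot α f =ᵐ[haarAddCircle] fun x => f (x + (α : UnitAddCircle)) :=
  Lp.coeFn_compMeasurePreserving f
    (measurePreserving_add_right haarAddCircle (α : UnitAddCircle))

theorem ξ_eq_fourier (n : ℤ) (α : ℝ) : fourier n (α : UnitAddCircle) = ξ (n * α) := by
  rw [fourier_coe_apply, ξ]
  congr 1
  push_cast
  ring

theorem rot_fourierLp (α : ℝ) (n : ℤ) :
    rot α (fourierLp 2 n) = ξ (n * α) • fourierLp 2 n := by
  apply Lp.ext
  have hq := (measurePreserving_add_right (haarAddCircle : Measure UnitAddCircle)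
    (α : UnitAddCircle)).quasiMeasurePreserving.ae (coeFn_fourierLp (T := 1) 2 n)
  filter_upwards [rot_coeFn α (fourierLp 2 n), Lp.coeFn_smul (ξ (n * α)) (fourierLp (T := 1) 2 n),
    coeFn_fourierLp (T := 1) 2 n, hq] with x h1 h2 h3 h4
  rw [h1, h2, h4, Pi.smul_apply, h3, smul_eq_mul, ← ξ_eq_fourier]
  simp only [fourier_apply, smul_add, AddCircle.toCircle_add, Circle.coe_mul]
  ring

theorem Mξ_fourierLp (n : ℤ) : Mξ (fourierLp 2 n) = fourierLp 2 (n + 1) := by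
  apply Lp.ext
  filter_upwards [mulOp_coeFn (fourierLp ∞ 1) (fourierLp 2 n), coeFn_fourierLp (T := 1) ∞ 1,
    coeFn_fourierLp (T := 1) 2 n, coeFn_fourierLp (T := 1) 2 (n + 1)] with x h1 h2 h3 h4
  rw [Mξ, h1, h2, h3, h4, fourier_add, mul_comm]

theorem mem_unitary_of_norm {A B : L2T →L[ℂ] L2T} (hA : ∀ f, ‖A f‖ = ‖f‖) (hAB : A * B = 1) :
    A ∈ unitary (L2T →L[ℂ] L2T) := by
  have h1 : star A * A = 1 := (ContinuousLinearMap.norm_map_iff_adjoint_comp_self A).1 hA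
  have h2 : star A = B := left_inv_eq_right_inv h1 hAB
  exact ⟨h1, by rw [h2, hAB]⟩

theorem rot_mem_unitary (α : ℝ) : rot α ∈ unitary (L2T →L[ℂ] L2T) := by
  refine mem_unitary_of_norm (B := rot (-α)) (fun f => LinearIsometry.norm_map _ f) ?_
  refine ext_fourierLp fun n => ?_
  rw [mul_apply_eq_comp, rot_fourierLp, map_smul, rot_fourierLp, smul_smul, ξ, ξ,
    ← Complex.exp_add]
  simp

theorem Mξ_mem_unitary : Mξ ∈ unitary (L2T →L[ℂ] L2T) := by
  refine mem_unitary_of_norm (B := mulOp (fourierLp ∞ (-1))) (fun f => ?_) ?_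
  · have h : ∀ᵐ x ∂(haarAddCircle : Measure UnitAddCircle), ‖Mξ f x‖ = ‖f x‖ := by
      filter_upwards [mulOp_coeFn (fourierLp ∞ 1) f, coeFn_fourierLp (T := 1) ∞ 1] with x h1 h2
      rw [Mξ, h1, h2, norm_mul, fourier_apply, Circle.norm_coe, one_mul]
    exact le_antisymm (Lp.norm_le_norm_of_ae_le (h.mono fun _ hx => hx.le))
      (Lp.norm_le_norm_of_ae_le (h.mono fun _ hx => hx.ge))
  · ext1 f
    apply Lp.ext
    filter_upwards [mulOp_coeFn (fourierLp ∞ 1) (mulOp (fourierLp ∞ (-1)) f),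
      mulOp_coeFn (fourierLp ∞ (-1)) f, coeFn_fourierLp (T := 1) ∞ 1,
      coeFn_fourierLp (T := 1) ∞ (-1)] with x h1 h2 h3 h4
    rw [mul_apply_eq_comp, Mξ, h1, h2, h3, h4, ← mul_assoc, ← fourier_add]
    simp

theorem rot_mul_Mξ (α : ℝ) :
    rot α * Mξ = Complex.exp (2 * Real.pi * Complex.I * α) • (Mξ * rot α) := by
  refine ext_fourierLp fun n => ?_
  rw [mul_apply_eq_comp, _root_.smul_apply,
    mul_apply_eq_comp, Mξ_fourierLp, rot_fourierLp, rot_fourierLp, map_smul,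
    Mξ_fourierLp, smul_smul, ξ, ξ, ← Complex.exp_add]
  congr 2
  push_cast
  ring

theorem ξ_mem_unitary (θ : ℝ) : ξ θ ∈ unitary ℂ := by
  have h : ‖ξ θ‖ = 1 := by
    have : ξ θ = Complex.exp ((2 * Real.pi * θ : ℝ) * Complex.I) := by
      rw [ξ]; push_cast; ring_nf
    rw [this, Complex.norm_exp_ofReal_mul_I]
  have h2 : star (ξ θ) * ξ θ = 1 := by
    rw [Complex.star_def, ← Complex.normSq_eq_conj_mul_self, Complex.normSq_eq_norm_sq, h]
    simp
  exact ⟨h2, by rw [mul_comm, h2]⟩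

theorem rot_mem (α : ℝ) : rot α ∈ rotationOperatorAlgebra α :=
  StarSubalgebra.le_topologicalClosure _ (StarAlgebra.subset_adjoin _ _ (Or.inl rfl))

theorem Mξ_mem (α : ℝ) : Mξ ∈ rotationOperatorAlgebra α :=
  StarSubalgebra.le_topologicalClosure _ (StarAlgebra.subset_adjoin _ _ (Or.inr rfl))

theorem isRotationPair (α θ : ℝ) : IsRotationPair α
    (ξ θ • (⟨rot α, rot_mem α⟩ : rotationOperatorAlgebra α))
    (⟨Mξ, Mξ_mem α⟩ : rotationOperatorAlgebra α) where
  unitary_left := by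
    have h := ξ_mem_unitary θ
    have hr := rot_mem_unitary α
    constructor <;>
    · rw [star_smul, smul_mul_smul_comm]
      simp only [h.1, h.2, one_smul]
      exact Subtype.ext (by first | exact hr.1 | exact hr.2)
  unitary_right :=
    ⟨Subtype.ext Mξ_mem_unitary.1, Subtype.ext Mξ_mem_unitary.2⟩
  comm := by
    rw [smul_mul_assoc, mul_smul_comm, smul_comm]
    exact congrArg _ (Subtype.ext (rot_mul_Mξ α))

/-- The `*`-homomorphism `π_θ` from the universal rotation algebra to the rotation algebra on
`L²(𝕋)`, determined by `U ↦ ξ₁(θ) R(α)` and `V ↦ M(ξ₁)`. -/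
def piTheta (α θ : ℝ) : RotationAlgebra α →⋆ₐ[ℂ] rotationOperatorAlgebra α :=
  RotationAlgebra.lift (isRotationPair α θ)

theorem piTheta_U (α θ : ℝ) :
    (piTheta α θ (RotationAlgebra.U α) : L2T →L[ℂ] L2T) = ξ θ • rot α :=
  congrArg Subtype.val (RotationAlgebra.lift_U (isRotationPair α θ))

theorem piTheta_V (α θ : ℝ) :
    (piTheta α θ (RotationAlgebra.V α) : L2T →L[ℂ] L2T) = Mξ :=
  congrArg Subtype.val (RotationAlgebra.lift_V (isRotationPair α θ))

end KickedRotor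

end

/-!
The statement rests on one fact: for irrational `α` every unital homomorphism `π` from the rotation
algebra to a nonzero `C*`-algebra is injective (`RotationAlgebra.starAlgHom_injective`).

The torus acts on the rotation algebra by `U ↦ exp(2πis) U`, `V ↦ exp(2πit) V`. The commutation
relation makes this action inner at the points `(α, 0)` and `(0, α)`, hence on the subgroup that
they generate, which is dense when `α` is irrational; so `ker π` is invariant under the whole
action (`RotationAlgebra.gaugeAt_mem_ker`). The average of an element over the torus is a scalar
(`RotationAlgebra.integral_gauge_mem_span`): up to scalars a word in `U`, `V` is a monomial
`U ^ m V ^ n`, and it is multiplied by the character `(m, n)` of the torus, whose mean is zero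
unless `m = n = 0`. If `π a = 0`, the average of `a⋆ a` is therefore a scalar in `ker π`, i.e. zero,
and since a continuous nonnegative function with zero integral vanishes
(`eq_zero_of_integral_eq_zero_of_nonneg`), `a = 0`. To have continuity of the orbits for free, the
action is constructed as a single homomorphism into the algebra of continuous functions on the
torus.

Injective homomorphisms are isometric, so they have closed range and preserve spectra
(`StarAlgHom.spectrum_apply_of_injective`); this gives the bijectivity of `π_θ` and the equality of
spectra. For rational `α = p / q` the element `U^q - ξ(qθ)` is a nonzero element of `ker π_θ`
(`KickedRotor.not_injective_piTheta`).

Finally, the two kicked operators are the images of one and the same element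
`exp(-iκ(V + V⋆)) exp(-iκλ(U + U⋆))` under two representations of the rotation algebra: `π_θ₁` for
the kicked Harper operator, and `U ↦ exp(πiα) ξ(θ₂) M(ξ₁) R(α)`, `V ↦ M(ξ₁)` for the double kicked
rotor. Both representations are injective when `α` is irrational, so both spectra are the spectrum
of that element.
-/

/-! ### Injective homomorphisms and spectra -/

/-- Spectral permanence for an injective unital homomorphism of `C*`-algebras: such a map is
isometric, hence identifies its domain with a closed subalgebra of the target. -/
theorem StarAlgHom.spectrum_apply_of_injective {A B : Type*} [CStarAlgebra A] [CStarAlgebra B]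
    (φ : A →⋆ₐ[ℂ] B) (hφ : Function.Injective φ) (a : A) :
    spectrum ℂ (φ a) = spectrum ℂ a := by
  have : IsClosed (φ.range : Set B) :=
    (NonUnitalStarAlgHom.isometry φ hφ).isClosedEmbedding.isClosed_range
  have h1 : spectrum ℂ (StarAlgEquiv.ofInjective φ hφ a) = spectrum ℂ a :=
    AlgEquiv.spectrum_eq (StarAlgEquiv.ofInjective φ hφ).toAlgEquiv a
  rw [← h1, StarSubalgebra.spectrum_eq φ.range]
  rfl

/-! ### Faithfulness of integration of positive elements -/

section Faithful

open MeasureTheory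

/-- A continuous function with nonnegative values in a `C*`-algebra and zero integral vanishes. -/
theorem eq_zero_of_integral_eq_zero_of_nonneg {X A : Type*} [TopologicalSpace X]
    [CompactSpace X] [MeasurableSpace X] [OpensMeasurableSpace X]
    (μ : Measure X) [IsFiniteMeasure μ] [μ.IsOpenPosMeasure]
    [CStarAlgebra A] [PartialOrder A] [StarOrderedRing A]
    {f : X → A} (hf : Continuous f) (h0 : ∀ x, 0 ≤ f x) (hI : ∫ x, f x ∂μ = 0) (x : X) :
    f x = 0 := by
  have hint : Integrable f μ :=
    hf.integrable_of_hasCompactSupport (HasCompactSupport.of_compactSpace f)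
  rw [← norm_le_zero_iff]
  refine le_of_forall_pos_le_add fun ε hε => ?_
  rw [zero_add]
  -- On a neighbourhood `s` of `x`, `f` is `ε`-close to `f x`, and its integral over `s` is zero.
  let s : Set X := {y | ‖f x - f y‖ < ε}
  have hs : IsOpen s := isOpen_lt (by fun_prop) continuous_const
  have hxs : x ∈ s := by simpa [s] using hε
  have hμ : 0 < μ.real s :=
    ENNReal.toReal_pos (hs.measure_pos μ ⟨x, hxs⟩).ne' (measure_ne_top μ s)
  have hsI : ∫ y in s, f y ∂μ = 0 :=
    le_antisymm
      ((setIntegral_le_integral hint (Filter.Eventually.of_forall h0)).trans hI.le)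
      (integral_nonneg h0)
  have h1 : ∫ y in s, (f x - f y) ∂μ = μ.real s • f x := by
    rw [integral_sub (integrable_const _) hint.integrableOn, hsI, sub_zero, setIntegral_const]
  have h2 : ‖∫ y in s, (f x - f y) ∂μ‖ ≤ ε * μ.real s :=
    norm_setIntegral_le_of_norm_le_const (measure_lt_top μ s) fun y hy => le_of_lt hy
  rw [h1, norm_smul, Real.norm_of_nonneg hμ.le, mul_comm] at h2
  exact le_of_mul_le_mul_right h2 hμ

theorem integral_fourier (n : ℤ) :
    ∫ x : UnitAddCircle, (fourier n x : ℂ) ∂AddCircle.haarAddCircle = if n = 0 then 1 else 0 := by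
  have h := congrFun (fourierCoeff_fourier (T := 1) n) 0
  rw [fourierCoeff] at h
  simpa [Pi.single_apply, eq_comm] using h

end Faithful

/-! ### Rotation pairs -/

theorem smul_mem_unitary {D : Type*} [CStarAlgebra D] {c : ℂ} (hc : c ∈ unitary ℂ) {w : D}
    (hw : w ∈ unitary D) : c • w ∈ unitary D := by
  constructor
  · rw [star_smul, smul_mul_smul_comm, hc.1, hw.1, one_smul]
  · rw [star_smul, smul_mul_smul_comm, hc.2, hw.2, one_smul]

theorem IsRotationPair.map {D E : Type*} [CStarAlgebra D] [CStarAlgebra E] {α : ℝ} {X Y : D}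
    (h : IsRotationPair α X Y) (φ : D →⋆ₐ[ℂ] E) : IsRotationPair α (φ X) (φ Y) where
  unitary_left := Unitary.map_mem φ h.unitary_left
  unitary_right := Unitary.map_mem φ h.unitary_right
  comm := by rw [← map_mul, h.comm, map_smul, map_mul]

namespace RotationAlgebra

open MeasureTheory AddCircle

noncomputable section

variable {α : ℝ}

theorem starAlgHom_ext {D : Type*} [CStarAlgebra D] {φ ψ : RotationAlgebra α →⋆ₐ[ℂ] D}
    (hU : φ (U α) = ψ (U α)) (hV : φ (V α) = ψ (V α)) : φ = ψ :=
  (existsUnique_lift (isRotationPair.map φ)).unique ⟨rfl, rfl⟩ ⟨hU.symm, hV.symm⟩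

theorem continuous_starAlgHom {D : Type*} [CStarAlgebra D] (φ : RotationAlgebra α →⋆ₐ[ℂ] D) :
    Continuous φ :=
  AddMonoidHomClass.continuous_of_bound φ 1
    (by simpa using NonUnitalStarAlgHom.norm_apply_le φ)

/-! ### The gauge action of the torus -/

theorem fourier_mem_unitary (n : ℤ) (x : UnitAddCircle) : (fourier n x : ℂ) ∈ unitary ℂ := by
  have h : star (fourier n x : ℂ) * fourier n x = 1 := by
    rw [Complex.star_def, ← fourier_neg, ← fourier_add]
    simp
  exact ⟨h, by rw [mul_comm, h]⟩

/-- The functions `(s, t) ↦ exp(2πis) U` and `(s, t) ↦ exp(2πit) V` on the torus form a rotation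
pair. -/
theorem isRotationPair_gauge (α : ℝ) :
    IsRotationPair (D := C(UnitAddCircle × UnitAddCircle, RotationAlgebra α)) α
      ⟨fun p => (fourier 1 p.1 : ℂ) • U α, by fun_prop⟩
      ⟨fun p => (fourier 1 p.2 : ℂ) • V α, by fun_prop⟩ where
  unitary_left := by
    have h p := smul_mem_unitary (fourier_mem_unitary 1 p) (isRotationPair (α := α)).unitary_left
    exact ⟨ContinuousMap.ext fun p => (h p.1).1, ContinuousMap.ext fun p => (h p.1).2⟩
  unitary_right := by
    have h p := smul_mem_unitary (fourier_mem_unitary 1 p) (isRotationPair (α := α)).unitary_right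
    exact ⟨ContinuousMap.ext fun p => (h p.2).1, ContinuousMap.ext fun p => (h p.2).2⟩
  comm := by
    ext1 p
    change ((fourier 1 p.1 : ℂ) • U α) * ((fourier 1 p.2 : ℂ) • V α) =
      Complex.exp (2 * Real.pi * Complex.I * α) •
        (((fourier 1 p.2 : ℂ) • V α) * ((fourier 1 p.1 : ℂ) • U α))
    rw [smul_mul_smul_comm, smul_mul_smul_comm, isRotationPair.comm, smul_comm,
      mul_comm (fourier 1 p.1 : ℂ)]

variable (α) in
/-- The gauge action of the torus, as a single homomorphism that sends `a` to its orbit map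
`p ↦ gauge α a p`; it is determined by `gauge α U (s, t) = exp(2πis) U` and
`gauge α V (s, t) = exp(2πit) V`. -/
def gauge : RotationAlgebra α →⋆ₐ[ℂ] C(UnitAddCircle × UnitAddCircle, RotationAlgebra α) :=
  lift (isRotationPair_gauge α)

variable (α) in
/-- The gauge homomorphism of `RotationAlgebra α` at a point of the torus. -/
def gaugeAt (p : UnitAddCircle × UnitAddCircle) : RotationAlgebra α →⋆ₐ[ℂ] RotationAlgebra α where
  toFun a := gauge α a p
  map_one' := by simp
  map_mul' := by simp
  map_zero' := by simp
  map_add' := by simp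
  commutes' c := by rw [AlgHomClass.commutes (gauge α)]; rfl
  map_star' a := by rw [map_star]; rfl

theorem gaugeAt_U (p : UnitAddCircle × UnitAddCircle) :
    gaugeAt α p (U α) = (fourier 1 p.1 : ℂ) • U α :=
  congrArg (fun f : C(UnitAddCircle × UnitAddCircle, RotationAlgebra α) => f p)
    (lift_U (isRotationPair_gauge α))

theorem gaugeAt_V (p : UnitAddCircle × UnitAddCircle) :
    gaugeAt α p (V α) = (fourier 1 p.2 : ℂ) • V α :=
  congrArg (fun f : C(UnitAddCircle × UnitAddCircle, RotationAlgebra α) => f p)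
    (lift_V (isRotationPair_gauge α))

theorem gaugeAt_zero (a : RotationAlgebra α) : gaugeAt α 0 a = a := by
  have : gaugeAt α 0 = StarAlgHom.id ℂ (RotationAlgebra α) :=
    starAlgHom_ext (by simp [gaugeAt_U]) (by simp [gaugeAt_V])
  rw [this, StarAlgHom.coe_id, id]

theorem gaugeAt_add (p q : UnitAddCircle × UnitAddCircle) (a : RotationAlgebra α) :
    gaugeAt α (p + q) a = gaugeAt α p (gaugeAt α q a) := by
  have : gaugeAt α (p + q) = (gaugeAt α p).comp (gaugeAt α q) := by
    refine starAlgHom_ext ?_ ?_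
    · simp [gaugeAt_U, smul_smul, AddCircle.toCircle_add, mul_comm]
    · simp [gaugeAt_V, smul_smul, AddCircle.toCircle_add, mul_comm]
  rw [this, StarAlgHom.comp_apply]

theorem fourier_one_coe (α : ℝ) :
    (fourier 1 (α : UnitAddCircle) : ℂ) = Complex.exp (2 * Real.pi * Complex.I * α) := by
  rw [fourier_coe_apply]
  congr 1
  push_cast
  ring

/-- By the commutation relation, the gauge homomorphism at `(α, 0)` is inner. -/
theorem gaugeAt_left (a : RotationAlgebra α) :
    gaugeAt α ((α : UnitAddCircle), 0) a = star (V α) * a * V α := by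
  let v : unitary (RotationAlgebra α) := ⟨V α, isRotationPair.unitary_right⟩
  have : gaugeAt α ((α : UnitAddCircle), 0) =
      (Unitary.conjStarAlgAut ℂ (RotationAlgebra α) (star v)).toStarAlgHom := by
    have hV : star (V α) * V α = 1 := isRotationPair.unitary_right.1
    refine starAlgHom_ext ?_ ?_
    · change _ = Unitary.conjStarAlgAut ℂ (RotationAlgebra α) (star v) (U α)
      rw [gaugeAt_U, Unitary.conjStarAlgAut_apply, fourier_one_coe]
      simp only [v, Unitary.coe_star, star_star]
      rw [mul_assoc (star (V α)), isRotationPair.comm, mul_smul_comm, ← mul_assoc (star (V α)), hV,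
        one_mul]
    · change _ = Unitary.conjStarAlgAut ℂ (RotationAlgebra α) (star v) (V α)
      rw [gaugeAt_V, Unitary.conjStarAlgAut_apply]
      simp [v, hV]
  rw [this]
  change Unitary.conjStarAlgAut ℂ (RotationAlgebra α) (star v) a = _
  rw [Unitary.conjStarAlgAut_apply]
  simp [v]

/-- By the commutation relation, the gauge homomorphism at `(0, α)` is inner. -/
theorem gaugeAt_right (a : RotationAlgebra α) :
    gaugeAt α (0, (α : UnitAddCircle)) a = U α * a * star (U α) := by
  let u : unitary (RotationAlgebra α) := ⟨U α, isRotationPair.unitary_left⟩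
  have : gaugeAt α (0, (α : UnitAddCircle)) =
      (Unitary.conjStarAlgAut ℂ (RotationAlgebra α) u).toStarAlgHom := by
    have hU : U α * star (U α) = 1 := isRotationPair.unitary_left.2
    refine starAlgHom_ext ?_ ?_
    · change _ = Unitary.conjStarAlgAut ℂ (RotationAlgebra α) u (U α)
      rw [gaugeAt_U, Unitary.conjStarAlgAut_apply]
      simp [u, hU, mul_assoc]
    · change _ = Unitary.conjStarAlgAut ℂ (RotationAlgebra α) u (V α)
      rw [gaugeAt_V, Unitary.conjStarAlgAut_apply, fourier_one_coe]
      simp only [u]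
      rw [isRotationPair.comm, smul_mul_assoc, mul_assoc (V α), hU, mul_one]
  rw [this]
  change Unitary.conjStarAlgAut ℂ (RotationAlgebra α) u a = _
  rw [Unitary.conjStarAlgAut_apply]

theorem unitary_conj_eq_zero_iff {D : Type*} [CStarAlgebra D] {w : D} (hw : w ∈ unitary D)
    (x : D) : star w * x * w = 0 ↔ x = 0 := by
  refine ⟨fun h => ?_, fun h => by simp [h]⟩
  calc x = (w * star w) * x * (w * star w) := by rw [hw.2, one_mul, mul_one]
    _ = w * (star w * x * w) * star w := by simp only [mul_assoc]
    _ = 0 := by rw [h, mul_zero, zero_mul]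

/-- The points of the torus whose gauge homomorphism preserves and reflects membership in the
kernel of `π`. -/
def gaugeStabilizer {D : Type*} [CStarAlgebra D] (π : RotationAlgebra α →⋆ₐ[ℂ] D) :
    AddSubgroup (UnitAddCircle × UnitAddCircle) where
  carrier := {p | ∀ a, π (gaugeAt α p a) = 0 ↔ π a = 0}
  zero_mem' a := by rw [gaugeAt_zero]
  add_mem' {p q} hp hq a := by rw [gaugeAt_add, hp, hq]
  neg_mem' {p} hp a := by rw [← hp, ← gaugeAt_add, add_neg_cancel, gaugeAt_zero]

/-- For irrational `α` every kernel is gauge invariant: the points of the torus with inner gauge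
homomorphism are dense. -/
theorem gaugeAt_mem_ker (hα : Irrational α) {D : Type*} [CStarAlgebra D]
    (π : RotationAlgebra α →⋆ₐ[ℂ] D) {a : RotationAlgebra α} (ha : π a = 0)
    (p : UnitAddCircle × UnitAddCircle) : π (gaugeAt α p a) = 0 := by
  have h1 : ((α : UnitAddCircle), (0 : UnitAddCircle)) ∈ gaugeStabilizer π := fun a => by
    rw [gaugeAt_left, map_mul, map_mul, map_star]
    exact unitary_conj_eq_zero_iff (isRotationPair.map π).unitary_right _
  have h2 : ((0 : UnitAddCircle), (α : UnitAddCircle)) ∈ gaugeStabilizer π := fun a => by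
    rw [gaugeAt_right, map_mul, map_mul, map_star]
    have := unitary_conj_eq_zero_iff (Unitary.star_mem (isRotationPair.map π).unitary_left) (π a)
    rwa [star_star] at this
  have hd : DenseRange fun k : ℤ => k • (α : UnitAddCircle) :=
    AddCircle.denseRange_zsmul_coe_iff.2 (by simpa using hα)
  have hcl : IsClosed {p | π (gauge α a p) = 0} :=
    isClosed_eq ((continuous_starAlgHom π).comp (gauge α a).continuous) continuous_const
  refine (hd.prodMap hd).induction_on (p := fun p => π (gauge α a p) = 0) p hcl fun k => ?_
  have hk : Prod.map (fun k : ℤ => k • (α : UnitAddCircle))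
      (fun k : ℤ => k • (α : UnitAddCircle)) k ∈ gaugeStabilizer π := by
    convert add_mem (zsmul_mem h1 k.1) (zsmul_mem h2 k.2) using 1
    ext <;> simp
  exact (hk a).2 ha

/-! ### Averages over the gauge action are scalars -/

/-- The normal subgroup of the unitaries that are scalar multiples of `1`. -/
def scalarUnitary (D : Type*) [CStarAlgebra D] : Subgroup (unitary D) where
  carrier := {w | ∃ c : ℂ, (w : D) = c • 1}
  one_mem' := ⟨1, by simp⟩
  mul_mem' := by
    rintro x y ⟨c, hc⟩ ⟨d, hd⟩
    exact ⟨c * d, by simp [hc, hd, smul_smul, mul_comm]⟩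
  inv_mem' := by
    rintro x ⟨c, hc⟩
    exact ⟨star c, by rw [← Unitary.star_eq_inv, Unitary.coe_star, hc, star_smul, star_one]⟩

instance (D : Type*) [CStarAlgebra D] : (scalarUnitary D).Normal where
  conj_mem := by
    rintro x ⟨c, hc⟩ w
    refine ⟨c, ?_⟩
    rw [← Unitary.star_eq_inv, Submonoid.coe_mul, Submonoid.coe_mul, hc, mul_smul_comm, mul_one,
      smul_mul_assoc, Unitary.coe_mul_star_self]

variable (α) in
/-- The unitary of the rotation algebra that is given by a word in the generators. -/
def word : FreeGroup (Fin 2) →* unitary (RotationAlgebra α) where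
  toFun g := ⟨ofPre (RotationPre.mono g 1), ofPre_mono_mem_unitary g⟩
  map_one' := Subtype.ext (map_one ofPre)
  map_mul' g h := Subtype.ext (by
    rw [Submonoid.coe_mul, ← map_mul, RotationPre.mono_mul, one_mul])

/-- The two generators commute up to scalars. -/
theorem commute_mk_word : Commute
    (QuotientGroup.mk' (scalarUnitary (RotationAlgebra α)) (word α (FreeGroup.of 0)))
    (QuotientGroup.mk' (scalarUnitary (RotationAlgebra α)) (word α (FreeGroup.of 1))) := by
  rw [Commute, SemiconjBy, ← map_mul, ← map_mul]
  refine QuotientGroup.eq.2 ⟨star (Complex.exp (2 * Real.pi * Complex.I * α)), ?_⟩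
  have h : (word α (FreeGroup.of 0) : RotationAlgebra α) * word α (FreeGroup.of 1) = _ :=
    (isRotationPair (α := α)).comm
  have h1 : star (V α * U α) * (V α * U α) = 1 :=
    (mul_mem isRotationPair.unitary_right isRotationPair.unitary_left).1
  rw [← Unitary.star_eq_inv, Submonoid.coe_mul, Unitary.coe_star, Submonoid.coe_mul,
    map_mul (word α), Submonoid.coe_mul, h, star_smul,
    smul_mul_assoc]
  exact congrArg _ h1

/-- A word acts like the monomial `U ^ m V ^ n`, both modulo scalars and for the gauge action. -/
theorem exists_exponents (g : FreeGroup (Fin 2)) :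
    ∃ m n : ℤ, QuotientGroup.mk' (scalarUnitary (RotationAlgebra α)) (word α g) =
        QuotientGroup.mk' _ (word α (FreeGroup.of 0)) ^ m *
          QuotientGroup.mk' _ (word α (FreeGroup.of 1)) ^ n ∧
      ∀ p, gaugeAt α p (word α g : RotationAlgebra α) =
        (fourier m p.1 * fourier n p.2 : ℂ) • (word α g : RotationAlgebra α) := by
  have hof : ∀ i : Fin 2, ∃ m n : ℤ,
      QuotientGroup.mk' (scalarUnitary (RotationAlgebra α)) (word α (FreeGroup.of i)) =
        QuotientGroup.mk' _ (word α (FreeGroup.of 0)) ^ m *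
          QuotientGroup.mk' _ (word α (FreeGroup.of 1)) ^ n ∧
      ∀ p, gaugeAt α p (word α (FreeGroup.of i) : RotationAlgebra α) =
        (fourier m p.1 * fourier n p.2 : ℂ) • (word α (FreeGroup.of i) : RotationAlgebra α) := by
    intro i
    fin_cases i
    · exact ⟨1, 0, by simp, fun p => by simpa using! gaugeAt_U p⟩
    · exact ⟨0, 1, by simp, fun p => by simpa using! gaugeAt_V p⟩
  induction g using FreeGroup.induction_on with
  | C1 => exact ⟨0, 0, by simp, fun p => by simp⟩
  | of i => exact hof i
  | inv_of i _ =>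
    obtain ⟨m, n, h1, h2⟩ := hof i
    refine ⟨-m, -n, ?_, fun p => ?_⟩
    · rw [map_inv, map_inv, h1, mul_inv_rev, zpow_neg, zpow_neg]
      exact (commute_mk_word.zpow_zpow m n).inv_inv.eq.symm
    · rw [map_inv, ← Unitary.star_eq_inv, Unitary.coe_star, map_star, h2, star_smul]
      congr 1
      simp
  | mul g h hg hh =>
    obtain ⟨m, n, h1, h2⟩ := hg
    obtain ⟨m', n', h1', h2'⟩ := hh
    refine ⟨m + m', n + n', ?_, fun p => ?_⟩
    · rw [map_mul, map_mul, h1, h1', zpow_add, zpow_add]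
      exact ((commute_mk_word.zpow_zpow m' n).symm.mul_mul_mul_comm _ _)
    · rw [map_mul, Submonoid.coe_mul, map_mul, h2, h2', smul_mul_smul_comm, fourier_add,
        fourier_add]
      congr 1
      ring

/-- Haar probability measure on the torus. -/
abbrev torusHaar : Measure (UnitAddCircle × UnitAddCircle) :=
  (haarAddCircle : Measure UnitAddCircle).prod haarAddCircle

theorem integrable_gauge (f : C(UnitAddCircle × UnitAddCircle, RotationAlgebra α)) :
    Integrable f torusHaar :=
  f.continuous.integrable_of_hasCompactSupport (HasCompactSupport.of_compactSpace f)

theorem continuous_integral_gauge :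
    Continuous fun a : RotationAlgebra α => ∫ p, gauge α a p ∂torusHaar := by
  have h : LipschitzWith 1 fun f : C(UnitAddCircle × UnitAddCircle, RotationAlgebra α) =>
      ∫ p, f p ∂torusHaar := by
    refine LipschitzWith.of_dist_le_mul fun f g => ?_
    rw [dist_eq_norm, dist_eq_norm, ← integral_sub (integrable_gauge f) (integrable_gauge g)]
    simpa using norm_integral_le_of_norm_le_const (μ := torusHaar)
      (Filter.Eventually.of_forall fun p => (f - g).norm_coe_le_norm p)
  exact h.continuous.comp (continuous_starAlgHom (gauge α))

/-- The average of an element over the gauge action is a scalar. -/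
theorem integral_gauge_mem_span (a : RotationAlgebra α) :
    ∫ p, gauge α a p ∂torusHaar ∈ Submodule.span ℂ {(1 : RotationAlgebra α)} := by
  have hcl : IsClosed (Submodule.span ℂ {(1 : RotationAlgebra α)} : Set (RotationAlgebra α)) :=
    Submodule.closed_of_finiteDimensional _
  refine induction_on
    (P := fun a => ∫ p, gauge α a p ∂torusHaar ∈ Submodule.span ℂ {(1 : RotationAlgebra α)}) a
    (hcl.preimage continuous_integral_gauge) fun x => ?_
  induction x using RotationPre.induction_linear with
  | zero => simp
  | add x y hx hy =>
    have : ∫ p, gauge α (ofPre (x + y)) p ∂torusHaar =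
        ∫ p, gauge α (ofPre x) p ∂torusHaar + ∫ p, gauge α (ofPre y) p ∂torusHaar := by
      rw [← integral_add (integrable_gauge _) (integrable_gauge _)]
      simp
    rw [this]
    exact add_mem hx hy
  | single g c =>
    obtain ⟨m, n, h1, h2⟩ := exists_exponents (α := α) g
    have hg p : gauge α (ofPre (RotationPre.mono g c)) p =
        (fourier m p.1 * fourier n p.2 : ℂ) • c • (word α g : RotationAlgebra α) := by
      have hc : (RotationPre.mono g c : RotationPre α) = c • RotationPre.mono g 1 := by
        simp [RotationPre.smul_mono]
      rw [hc, map_smul, map_smul, ContinuousMap.smul_apply, smul_comm]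
      exact congrArg (c • ·) (h2 p)
    simp_rw [hg]
    rw [integral_smul_const, torusHaar, integral_prod_mul (fun x => (fourier m x : ℂ))
      (fun y => (fourier n y : ℂ)), integral_fourier, integral_fourier]
    -- Only a word with both exponents zero has a nonzero average, and such a word is a scalar.
    by_cases hm : m = 0
    · by_cases hn : n = 0
      · subst hm hn
        rw [zpow_zero, zpow_zero, one_mul] at h1
        obtain ⟨d, hd⟩ := (QuotientGroup.eq_one_iff (word α g)).1 h1
        rw [hd]
        exact Submodule.smul_mem _ _ (Submodule.smul_mem _ _ (Submodule.smul_mem _ _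
          (Submodule.mem_span_singleton_self _)))
      · simp [hn]
    · simp [hm]

/-! ### Simplicity -/

/-- Simplicity of the irrational rotation algebra, in the form that every unital homomorphism to a
nonzero `C*`-algebra is injective. -/
theorem starAlgHom_injective (hα : Irrational α) {D : Type*} [CStarAlgebra D] [Nontrivial D]
    (π : RotationAlgebra α →⋆ₐ[ℂ] D) : Function.Injective π := by
  let _ : PartialOrder (RotationAlgebra α) := CStarAlgebra.spectralOrder _
  have _ : StarOrderedRing (RotationAlgebra α) := CStarAlgebra.spectralOrderedRing _
  refine (injective_iff_map_eq_zero π).2 fun a ha => ?_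
  have hker : π (star a * a) = 0 := by rw [map_mul, ha, mul_zero]
  -- The average of `star a * a` is a scalar that lies in the kernel of `π`, so it is zero.
  have hI : ∫ p, gauge α (star a * a) p ∂torusHaar = 0 := by
    obtain ⟨c, hc⟩ := Submodule.mem_span_singleton.1 (integral_gauge_mem_span (star a * a))
    let πL : RotationAlgebra α →L[ℂ] D := ⟨π.toAlgHom.toLinearMap, continuous_starAlgHom π⟩
    have h0 : πL (∫ p, gauge α (star a * a) p ∂torusHaar) = 0 := by
      rw [← πL.integral_comp_comm (integrable_gauge _)]
      exact integral_eq_zero_of_ae (Filter.Eventually.of_forall (gaugeAt_mem_ker hα π hker))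
    have h1 : c • (1 : D) = 0 := by
      rw [← hc, map_smul] at h0
      rw [← map_one π]
      exact h0
    rw [← hc, (smul_eq_zero.1 h1).resolve_right one_ne_zero, zero_smul]
  have hpos : ∀ p, 0 ≤ gauge α (star a * a) p := fun p => by
    rw [map_mul, map_star]
    exact star_mul_self_nonneg (gauge α a p)
  have h := eq_zero_of_integral_eq_zero_of_nonneg torusHaar (gauge α (star a * a)).continuous
    hpos hI 0
  exact CStarRing.star_mul_self_eq_zero_iff a |>.1 ((gaugeAt_zero _).symm.trans h)

end

end RotationAlgebra

namespace KickedRotor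

open MeasureTheory AddCircle

noncomputable section

/-! ### The homomorphisms `π_θ` -/

theorem ξ_add (s t : ℝ) : ξ (s + t) = ξ s * ξ t := by
  rw [ξ, ξ, ξ, ← Complex.exp_add]
  congr 1
  push_cast
  ring

theorem star_ξ (t : ℝ) : star (ξ t) = ξ (-t) := by
  refine (left_inv_eq_right_inv (ξ_mem_unitary t).1 ?_)
  rw [← ξ_add]
  simp [ξ]

instance : Nontrivial L2T :=
  ⟨⟨fourierLp 2 0, 0, fun h => one_ne_zero (α := ℝ) <| by
    rw [← (orthonormal_fourier (T := 1)).1 0, h, norm_zero]⟩⟩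

/-- For rational `α` with denominator `q` one has `R(α)^q = 1`, so `U^q - ξ(qθ)` is in the kernel of
`π_θ`. It is nonzero, since `π_θ'` with `θ' = θ + 1 / (2q)` maps it to `-2ξ(qθ)`. -/
theorem not_injective_piTheta {α : ℝ} (hα : ¬ Irrational α) (θ : ℝ) :
    ¬ Function.Injective (piTheta α θ) := by
  intro hinj
  obtain ⟨r, rfl⟩ : ∃ r : ℚ, (r : ℝ) = α := by simpa [Irrational] using hα
  have hden : (r.den : ℝ) ≠ 0 := by exact_mod_cast r.den_ne_zero
  have hU : ∀ t : ℝ, (piTheta r t (RotationAlgebra.U r ^ r.den) : L2T →L[ℂ] L2T) =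
      ξ (r.den * t) • 1 := by
    intro t
    have hξ : ∀ s : ℝ, ξ s ^ r.den = ξ (r.den * s) := fun s => by
      rw [ξ, ξ, ← Complex.exp_nat_mul]
      congr 1
      push_cast
      ring
    have hrot : rot r ^ r.den = 1 := by
      refine ext_fourierLp fun n => ?_
      have hk : ∀ k : ℕ, (rot r ^ k) (fourierLp 2 n) = ξ (n * r) ^ k • fourierLp 2 n := by
        intro k
        induction k with
        | zero => simp
        | succ k ih =>
          rw [pow_succ, mul_apply_eq_comp, rot_fourierLp, map_smul, ih, smul_smul,
            pow_succ, mul_comm]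
      have h1 : (r.den : ℝ) * (n * r) = (n * r.num : ℤ) := by
        have : (r : ℝ) * r.den = r.num := by exact_mod_cast r.mul_den_eq_num
        push_cast
        rw [← this]
        ring
      rw [hk, hξ, h1, ξ]
      have := Complex.exp_int_mul_two_pi_mul_I (n * r.num)
      rw [show 2 * (Real.pi : ℂ) * Complex.I * ((n * r.num : ℤ) : ℝ) =
        (n * r.num : ℤ) * (2 * Real.pi * Complex.I) by push_cast; ring, this]
      simp
    rw [map_pow, SubmonoidClass.coe_pow, piTheta_U, smul_pow, hrot, hξ]
  have heq : RotationAlgebra.U (r : ℝ) ^ r.den =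
      ξ (r.den * θ) • (1 : RotationAlgebra (r : ℝ)) := by
    refine hinj (Subtype.ext ?_)
    rw [hU, map_smul, map_one]
    rfl
  -- Comparison with `θ + 1 / (2q)`, where `U^q` is mapped to the opposite scalar.
  have h2 := hU (θ + 1 / (2 * r.den))
  rw [heq, map_smul, map_one] at h2
  have h3 : ξ (r.den * θ) • (1 : L2T →L[ℂ] L2T) = ξ (r.den * (θ + 1 / (2 * r.den))) • 1 := h2
  have h4 : (r.den : ℝ) * (θ + 1 / (2 * r.den)) = r.den * θ + 1 / 2 := by
    field_simp
  have h5 : ξ (1 / 2) = -1 := by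
    rw [ξ, ← Complex.exp_pi_mul_I]
    congr 1
    push_cast
    ring
  rw [h4, ξ_add, h5] at h3
  have h6 := smul_left_injective ℂ (one_ne_zero (α := L2T →L[ℂ] L2T)) h3
  have h7 : ξ (r.den * θ) ≠ 0 := Complex.exp_ne_zero _
  apply h7
  linear_combination h6 / 2

theorem injective_piTheta {α : ℝ} (hα : Irrational α) (θ : ℝ) :
    Function.Injective (piTheta α θ) :=
  RotationAlgebra.starAlgHom_injective hα _

/-- The range of an injective homomorphism is closed, and it contains the generators `R(α)` and
`M(ξ₁)`. -/
theorem surjective_piTheta {α : ℝ} (hα : Irrational α) (θ : ℝ) :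
    Function.Surjective (piTheta α θ) := by
  let φ : RotationAlgebra α →⋆ₐ[ℂ] L2T →L[ℂ] L2T :=
    (rotationOperatorAlgebra α).subtype.comp (piTheta α θ)
  have hφ : Function.Injective φ := RotationAlgebra.starAlgHom_injective hα φ
  have hcl : IsClosed (φ.range : Set (L2T →L[ℂ] L2T)) :=
    (NonUnitalStarAlgHom.isometry φ hφ).isClosedEmbedding.isClosed_range
  have hle : rotationOperatorAlgebra α ≤ φ.range := by
    refine StarSubalgebra.topologicalClosure_minimal (StarAlgebra.adjoin_le ?_) hcl
    rintro _ (rfl | rfl)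
    · refine ⟨ξ (-θ) • RotationAlgebra.U α, ?_⟩
      change φ (ξ (-θ) • RotationAlgebra.U α) = rot α
      rw [map_smul]
      change ξ (-θ) • (piTheta α θ (RotationAlgebra.U α) : L2T →L[ℂ] L2T) = _
      rw [piTheta_U, smul_smul, ← ξ_add]
      simp [ξ]
    · exact ⟨RotationAlgebra.V α, piTheta_V α θ⟩
  intro b
  obtain ⟨a, ha⟩ := hle b.2
  exact ⟨a, Subtype.ext ha⟩

/-! ### Kicked operators as images of one element of the rotation algebra -/

theorem star_apply_eq {A : L2T →L[ℂ] L2T} (hA : A ∈ unitary (L2T →L[ℂ] L2T)) {f g : L2T}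
    (h : A f = g) : star A g = f := by
  rw [← h, ← mul_apply_eq_comp, hA.1, one_apply_eq_self]

theorem star_Mξ_fourierLp (n : ℤ) : star Mξ (fourierLp 2 n) = fourierLp 2 (n - 1) :=
  star_apply_eq Mξ_mem_unitary (by rw [Mξ_fourierLp, sub_add_cancel])

theorem star_rot_fourierLp (α : ℝ) (n : ℤ) :
    star (rot α) (fourierLp 2 n) = ξ (-(n * α)) • fourierLp 2 n :=
  star_apply_eq (rot_mem_unitary α) (by
    rw [map_smul, rot_fourierLp, smul_smul, ← ξ_add]
    simp [ξ])

theorem cos_eq_ξ (t : ℝ) : (Real.cos (2 * Real.pi * t) : ℂ) = (1 / 2 : ℂ) * (ξ t + ξ (-t)) := by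
  rw [Complex.ofReal_cos, Complex.cos, ξ, ξ]
  push_cast
  ring_nf

theorem cosMomentum_eq (α θ : ℝ) :
    cosMomentum α θ = (1 / 2 : ℂ) • (ξ θ • rot α + star (ξ θ • rot α)) := by
  refine ext_fourierLp fun n => ?_
  rw [cosMomentum_fourierLp, cos_eq_ξ, star_smul, star_ξ]
  simp only [_root_.smul_apply, _root_.add_apply, rot_fourierLp,
    star_rot_fourierLp, smul_smul, ← ξ_add, ← add_smul]
  rw [neg_add, add_comm (n * α), add_comm (-(n * α))]

theorem cosPosition_fourierLp (θ : ℝ) (n : ℤ) : cosPosition θ (fourierLp 2 n) =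
    (1 / 2 : ℂ) • (ξ θ • fourierLp 2 (n + 1) + ξ (-θ) • fourierLp 2 (n - 1)) := by
  apply Lp.ext
  filter_upwards [mulOp_coeFn (ContinuousMap.toLp ∞ (haarAddCircle : Measure UnitAddCircle) ℂ
      (cosFun θ)) (fourierLp 2 n),
    ContinuousMap.coeFn_toLp (p := ∞) (𝕜 := ℂ) (haarAddCircle : Measure UnitAddCircle) (cosFun θ),
    coeFn_fourierLp (T := 1) 2 n, coeFn_fourierLp (T := 1) 2 (n + 1),
    coeFn_fourierLp (T := 1) 2 (n - 1),
    Lp.coeFn_smul (1 / 2 : ℂ) (ξ θ • fourierLp (T := 1) 2 (n + 1) +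
      ξ (-θ) • fourierLp (T := 1) 2 (n - 1)),
    Lp.coeFn_add (ξ θ • fourierLp (T := 1) 2 (n + 1)) (ξ (-θ) • fourierLp (T := 1) 2 (n - 1)),
    Lp.coeFn_smul (ξ θ) (fourierLp (T := 1) 2 (n + 1)),
    Lp.coeFn_smul (ξ (-θ)) (fourierLp (T := 1) 2 (n - 1))] with x h1 h2 h3 h4 h5 h6 h7 h8 h9
  rw [cosPosition, h1, h2, h3, h6, Pi.smul_apply, h7, Pi.add_apply, h8, h9, Pi.smul_apply,
    Pi.smul_apply, h4, h5, fourier_add, sub_eq_add_neg, fourier_add]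
  have h : ∀ k : ℤ, (fourier k (x + (θ : UnitAddCircle)) : ℂ) = fourier k x * ξ (k * θ) := by
    intro k
    rw [← ξ_eq_fourier]
    simp [AddCircle.toCircle_add]
  have hc : cosFun θ x = (1 / 2 : ℂ) * (fourier 1 x * ξ θ + fourier (-1) x * ξ (-θ)) := by
    change (((fourier 1 (x + (θ : UnitAddCircle)) : ℂ).re : ℝ) : ℂ) = _
    rw [Complex.re_eq_add_conj, ← fourier_neg, h, h]
    simp
    ring
  rw [hc]
  simp only [smul_eq_mul]
  ring

theorem cosPosition_zero : cosPosition 0 = (1 / 2 : ℂ) • (Mξ + star Mξ) := by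
  refine ext_fourierLp fun n => ?_
  rw [cosPosition_fourierLp]
  simp [Mξ_fourierLp, star_Mξ_fourierLp, ξ]

theorem isRotationPair_rot (α θ : ℝ) : IsRotationPair α (ξ θ • rot α) Mξ where
  unitary_left := smul_mem_unitary (ξ_mem_unitary θ) (rot_mem_unitary α)
  unitary_right := Mξ_mem_unitary
  comm := by rw [smul_mul_assoc, mul_smul_comm, smul_comm, rot_mul_Mξ]

theorem isRotationPair_Mξ_rot (α t : ℝ) : IsRotationPair α (ξ t • (Mξ * rot α)) Mξ where
  unitary_left := smul_mem_unitary (ξ_mem_unitary t) (mul_mem Mξ_mem_unitary (rot_mem_unitary α))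
  unitary_right := Mξ_mem_unitary
  comm := by
    rw [smul_mul_assoc, mul_smul_comm, smul_comm, mul_assoc, rot_mul_Mξ, mul_smul_comm]

/-- Conjugation by the free propagator turns `M(ξ₁)` into `exp(πiα) M(ξ₁) R(α)`, because
`(n + 1)² - n² = 2n + 1`. -/
theorem freeProp_conj_cosPosition (α θ : ℝ) :
    freeProp α * cosPosition θ * freeProp (-α) = (1 / 2 : ℂ) •
      (ξ (α / 2 + θ) • (Mξ * rot α) + star (ξ (α / 2 + θ) • (Mξ * rot α))) := by
  have hT : ∀ (β : ℝ) (n : ℤ), freeProp β (fourierLp 2 n) =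
      ξ (β / 2 * (n : ℝ) ^ 2) • fourierLp 2 n := fun β n => by
    rw [freeProp_fourierLp, ξ]
    congr 2
    push_cast
    ring
  refine ext_fourierLp fun n => ?_
  rw [star_smul, star_ξ, star_mul]
  simp only [mul_apply_eq_comp, _root_.smul_apply,
    _root_.add_apply, hT, map_smul, cosPosition_fourierLp, map_add, rot_fourierLp,
    Mξ_fourierLp, star_Mξ_fourierLp, star_rot_fourierLp, smul_smul, smul_add, mul_assoc,
    mul_left_comm (ξ _) (1 / 2 : ℂ), ← ξ_add]
  congr 4
  · push_cast
    ring
  · push_cast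
    ring

/-- The element `exp(c (V + V⋆) / 2) exp(d (U + U⋆) / 2)` of the rotation algebra. -/
def kickElement (α : ℝ) (c d : ℂ) : RotationAlgebra α :=
  NormedSpace.exp (c • (1 / 2 : ℂ) • (RotationAlgebra.V α + star (RotationAlgebra.V α))) *
    NormedSpace.exp (d • (1 / 2 : ℂ) • (RotationAlgebra.U α + star (RotationAlgebra.U α)))

theorem lift_kickElement {D : Type*} [CStarAlgebra D] {α : ℝ} {X Y : D}
    (h : IsRotationPair α X Y) (c d : ℂ) :
    RotationAlgebra.lift h (kickElement α c d) =
      NormedSpace.exp (c • (1 / 2 : ℂ) • (Y + star Y)) *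
        NormedSpace.exp (d • (1 / 2 : ℂ) • (X + star X)) := by
  let _ : NormedAlgebra ℚ D := .restrictScalars ℚ ℂ D
  let _ : NormedAlgebra ℚ (RotationAlgebra α) := .restrictScalars ℚ ℂ _
  have hc := RotationAlgebra.continuous_starAlgHom (RotationAlgebra.lift h)
  rw [kickElement, map_mul, NormedSpace.map_exp _ hc, NormedSpace.map_exp _ hc]
  simp only [map_smul, map_add, map_star, RotationAlgebra.lift_U, RotationAlgebra.lift_V]

/-- The kicked Harper operator is the image of `kickElement` in the representation `π_θ`, regarded
with values in the bounded operators. -/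
theorem kickedHarper_eq (κ α lam θ : ℝ) : kickedHarper κ α lam θ =
    RotationAlgebra.lift (isRotationPair_rot α θ)
      (kickElement α (-2 * Complex.I * κ) (-2 * Complex.I * κ * lam)) := by
  rw [lift_kickElement, kickedHarper, cosPosition_zero, cosMomentum_eq]

/-- The double kicked rotor is the image of the same element of the rotation algebra in the
representation `U ↦ ξ(α / 2 + θ) M(ξ₁) R(α)`, `V ↦ M(ξ₁)`. -/
theorem doubleKickedRotor_eq (κ α lam θ : ℝ) : doubleKickedRotor κ α lam θ =
    RotationAlgebra.lift (isRotationPair_Mξ_rot α (α / 2 + θ))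
      (kickElement α (-2 * Complex.I * κ) (-2 * Complex.I * κ * lam)) := by
  let _ : NormedAlgebra ℚ (L2T →L[ℂ] L2T) := .restrictScalars ℚ ℂ _
  let T : (L2T →L[ℂ] L2T)ˣ :=
    ⟨freeProp α, freeProp (-α), freeProp_mul_neg α, freeProp_neg_mul α⟩
  rw [lift_kickElement, doubleKickedRotor, cosPosition_zero, ← freeProp_conj_cosPosition,
    mul_assoc, mul_assoc]
  congr 1
  have h := NormedSpace.exp_units_conj T ((-2 * Complex.I * κ * lam) • cosPosition θ)
  rw [mul_smul_comm, smul_mul_assoc] at h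
  rw [← mul_assoc]
  exact h.symm

theorem spectrum_kickedHarper_eq {α : ℝ} (hα : Irrational α) (κ lam θ₁ θ₂ : ℝ) :
    spectrum ℂ (kickedHarper κ α lam θ₁) = spectrum ℂ (doubleKickedRotor κ α lam θ₂) := by
  rw [kickedHarper_eq, doubleKickedRotor_eq,
    StarAlgHom.spectrum_apply_of_injective _ (RotationAlgebra.starAlgHom_injective hα _),
    StarAlgHom.spectrum_apply_of_injective _ (RotationAlgebra.starAlgHom_injective hα _)]

end

end KickedRotor

theorem mainTheorem3 (α : ℝ) (hα : α ∈ Set.Ico (0 : ℝ) 1) :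
    (∀ θ ∈ Set.Ico (0 : ℝ) 1,
      Function.Injective (KickedRotor.piTheta α θ) ↔ Irrational α) ∧
    (Irrational α →
      (∀ θ ∈ Set.Ico (0 : ℝ) 1, Function.Bijective (KickedRotor.piTheta α θ)) ∧
      Nonempty (RotationAlgebra α ≃⋆ₐ[ℂ] KickedRotor.rotationOperatorAlgebra α) ∧
      (∀ θ ∈ Set.Ico (0 : ℝ) 1, ∀ A : RotationAlgebra α,
        spectrum ℂ A = spectrum ℂ (KickedRotor.piTheta α θ A) ∧
        spectrum ℂ A =
          spectrum ℂ (KickedRotor.piTheta α θ A : KickedRotor.L2T →L[ℂ] KickedRotor.L2T)) ∧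
      (∀ κ lam : ℝ, ∀ θ₁ ∈ Set.Ico (0 : ℝ) 1, ∀ θ₂ ∈ Set.Ico (0 : ℝ) 1,
        spectrum ℂ (KickedRotor.kickedHarper κ α lam θ₁) =
          spectrum ℂ (KickedRotor.doubleKickedRotor κ α lam θ₂))) := by
  refine ⟨fun θ _ => ⟨fun h => ?_, fun h => KickedRotor.injective_piTheta h θ⟩, fun h => ?_⟩
  · by_contra hirr
    exact KickedRotor.not_injective_piTheta hirr θ h
  have hbij θ : Function.Bijective (KickedRotor.piTheta α θ) :=
    ⟨KickedRotor.injective_piTheta h θ, KickedRotor.surjective_piTheta h θ⟩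
  have hspec θ (A : RotationAlgebra α) :
      spectrum ℂ A = spectrum ℂ (KickedRotor.piTheta α θ A) :=
    (StarAlgHom.spectrum_apply_of_injective _ (hbij θ).1 A).symm
  exact ⟨fun θ _ => hbij θ, ⟨StarAlgEquiv.ofBijective _ (hbij 0)⟩,
    fun θ _ A => ⟨hspec θ A, (hspec θ A).trans (StarSubalgebra.spectrum_eq _)⟩,
    fun κ lam θ₁ _ θ₂ _ => KickedRotor.spectrum_kickedHarper_eq h κ lam θ₁ θ₂⟩
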